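/- Setting. There are $K\ge 2$ arms $a_1,\dots,a_K$, a time horizon $T\ge 2$, and changepoints $1=\nu_0<\nu_1<\dots<\nu_{M-1}<\nu_M=T+1$ dividing $\{1,\dots,T\}$ into $M$ segments $S_m=\{\nu_{m-1},\dots,\nu_m-1\}$. Segment $m$ has a preference matrix $P^{(m)}=(p^{(m)}_{i,j})\in[0,1]^{K\times K}$ with $p^{(m)}_{i,j}+p^{(m)}_{j,i}=1$ and a Condorcet winner $a_{m^*}$, i.e. $p^{(m)}_{m^*,i}>\frac12$ for all $i\ne m^*$. If the pair $(a_I,a_J)$ is played at a time $t\in S_m$, then $a_I$ wins with probability $p^{(m)}_{I,J}$, independently of everything else given the choice of the pair, and the binary weak regret is $\lceil\min\{p^{(m)}_{m^*,I}-\frac12,\;p^{(m)}_{m^*,J}-\frac12\}\rceil$; $R^{\bar{\mathrm W}}(T)$ is the sum of these regrets over $t=1,\dots,T$. Let $\delta_*^{(m)}=\max_j|p^{(m+1)}_{m^*,j}-p^{(m)}_{m^*,j}|$ and $\delta_*=\min_{1\le m\le M-1}\delta_*^{(m)}$ (if $M=1$, let $\delta_*$ be any number in $(0,1]$), and assume $\delta_*>0$.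 Algorithm. Let $Alg$ be any (possibly randomized) dueling bandits algorithm that can report a suspected Condorcet winner at any time, and let $\tilde T\ge 0$ be an integer. DETECT with cap $\tilde T$, even window length $w$ and threshold $b>0$ works in cycles until the time horizon $T$ is reached. In each cycle it runs a fresh instance of $Alg$ for $\tilde T$ time steps and takes its suspected Condorcet winner $a_I$. It then plays the pairs $(a_I,a_j)$, $j\ne I$, cyclically in some fixed order, keeping for each $j$ the outcomes of the duels between $a_I$ and $a_j$ in this cycle. As soon as the pair just played has at least $w$ such outcomes, and among its last $w$ outcomes the numbers of wins of $a_I$ in the older and in the newer half differ by more than $b$, the cycle ends and a new one starts in the next time step. Let $p_{\tilde T}$ be any number such that, for every $m\le M$, $Alg$ run for $\tilde T$ steps in the stationary environment $P^{(m)}$ reports $a_{m^*}$ with probability at least $p_{\tilde T}$. Let $$R_M^{\bar{\mathrm W}}(Alg)=\sum_{m=1}^M\mathbb E\big[\tilde R^{\bar{\mathrm W}}(\nu_{m-1},\nu_{m-1}+\tilde T-1)\big],$$ where $\tilde R^{\bar{\mathrm W}}(t_1,t_2)$ is the cumulative binary weak regret that $Alg$ incurs when started at time $t_1$ and run on its own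 up to time $t_2$. Claim. Let $w$ be the lowest even integer $\ge 32\log T/\delta_*^2$, let $b=\sqrt{2w\log T}$ and $c=\sqrt{8\log T/w}$, and assume $|S_m|\ge\tilde T+\frac32w(K-1)$ for all $m\le M$. Then $b,c>0$ and $\delta_*\ge\frac{2b}{w}+c$, and the expected cumulative binary weak regret of DETECT satisfies $$\mathbb E\big[R^{\bar{\mathrm W}}(T)\big]\le C\,\frac{KM\log T}{\delta_*^2}+(1-p_{\tilde T})MT+R_M^{\bar{\mathrm W}}(Alg)$$ with a universal constant $C>0$, independent of $K,M,T$, the environment, $Alg$, $\tilde T$, $p_{\tilde T}$ and $\delta_*$. -/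

import Mathlib

noncomputable section

namespace DuelingBandits

/-- An ordered pair `(a_I, a_J)` of arms that is played in one time step. -/
abbrev ArmPair (K : ℕ) : Type := Fin K × Fin K

/-- A duel: the pair `(a_I, a_J)` that was played and its outcome, `true` if and only if
`a_I` has won against `a_J`. -/
abbrev Duel (K : ℕ) : Type := ArmPair K × Bool

/-- The Bernoulli distribution with success probability `p` on `Bool`. -/
def bernoulli (p : unitInterval) : PMF Bool :=
  PMF.ofFintype (fun x => ENNReal.ofReal (if x then (p : ℝ) else 1 - (p : ℝ))) (by
    have h0 : (0 : ℝ) ≤ p := p.2.1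
    have h1 : (0 : ℝ) ≤ 1 - (p : ℝ) := sub_nonneg.mpr p.2.2
    simp only [Fintype.sum_bool, if_true, Bool.false_eq_true, if_false]
    rw [← ENNReal.ofReal_add h0 h1]
    simp)

/-- The expected value of `f` under the discrete probability distribution `μ`. It is only applied
to distributions of finite support. -/
def expect {α : Type} (μ : PMF α) (f : α → ℝ) : ℝ := ∑' a, (μ a).toReal * f a

/-! ### The environment -/

/-- An instance of the non-stationary dueling bandits problem with `K` arms, time horizon `T`
and `M` stationary segments. The values `ν m` for `m > M`, `P m` and `star m` for `m = 0` or
`m > M` are irrelevant. -/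
structure Environment (K M T : ℕ) where
  /-- The changepoints `1 = ν 0 < ν 1 < … < ν M = T + 1`;
  segment `m` is `{ν (m - 1), …, ν m - 1}` for `1 ≤ m ≤ M`. -/
  ν : ℕ → ℕ
  ν_zero : ν 0 = 1
  ν_last : ν M = T + 1
  ν_lt : ∀ m, m < M → ν m < ν (m + 1)
  /-- `P m i j` is the probability that `a_i` wins against `a_j` in segment `m`. -/
  P : ℕ → Fin K → Fin K → unitInterval
  P_add : ∀ m, 1 ≤ m → m ≤ M → ∀ i j, (P m i j : ℝ) + (P m j i : ℝ) = 1
  /-- The index of the Condorcet winner of segment `m`. -/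
  star : ℕ → Fin K
  star_beats : ∀ m, 1 ≤ m → m ≤ M → ∀ i, i ≠ star m → (1 / 2 : ℝ) < (P m (star m) i : ℝ)

namespace Environment

variable {K M T : ℕ} (E : Environment K M T)

/-- The index of the segment that contains time step `t`: one plus the number of
changepoints among `ν 1, …, ν (M - 1)` that are at most `t`. -/
def seg (t : ℕ) : ℕ := 1 + ((Finset.Icc 1 (M - 1)).filter fun m => E.ν m ≤ t).card

/-- The preference matrix that governs time step `t`. -/
def prefAt (t : ℕ) : Fin K → Fin K → unitInterval := E.P (E.seg t)

/-- The suboptimality gap `Δ_i = P (m*, i) - 1/2` of arm `i` in segment `m`. -/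
def gap (m : ℕ) (i : Fin K) : ℝ := (E.P m (E.star m) i : ℝ) - 1 / 2

/-- The instantaneous weak regret of a pair in segment `m`. -/
def weakRegret (m : ℕ) (d : ArmPair K) : ℝ := min (E.gap m d.1) (E.gap m d.2)

/-- The instantaneous binary weak regret of a pair in segment `m`. -/
def binWeakRegret (m : ℕ) (d : ArmPair K) : ℝ := (⌈E.weakRegret m d⌉ : ℤ)

/-- The cumulative binary weak regret of a sequence of pairs that is played from time step `s`
on. The list has the most recent pair first, so its last entry is played at time `s`. -/
def cumRegret (s : ℕ) : List (ArmPair K) → ℝ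
  | [] => 0
  | d :: h => E.binWeakRegret (E.seg (s + h.length)) d + cumRegret s h

/-- The change `max_j |P^(m+1) (m*, j) - P^(m) (m*, j)|` at the changepoint `ν m` of the
preferences of the Condorcet winner `m*` of segment `m`. -/
def segChange (m : ℕ) : ℝ :=
  ⨆ j : Fin K, |(E.P (m + 1) (E.star m) j : ℝ) - (E.P m (E.star m) j : ℝ)|

/-- `δ` is the minimal segmental change `δ_*`: the minimum of `segChange m` over the changepoints
`1 ≤ m ≤ M - 1`. If there is no changepoint, any number in `(0, 1]` is admitted. -/
def IsMinSegChange (δ : ℝ) : Prop :=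
  if M ≤ 1 then 0 < δ ∧ δ ≤ 1 else IsLeast (E.segChange '' Set.Icc 1 (M - 1)) δ

end Environment

/-! ### The black-box algorithm -/

/-- A (possibly randomized) dueling bandits algorithm that reports a suspected Condorcet winner.
It is given by the conditional laws of its next pair and of its suspected Condorcet winner
given the duels (most recent first) that it has played since it was last (re)started. -/
structure BlackBox (K : ℕ) where
  /-- The law of the next pair. -/
  select : List (Duel K) → PMF (ArmPair K)
  /-- The law of the suspected Condorcet winner. -/
  suspect : List (Duel K) → PMF (Fin K)

namespace BlackBox

variable {K : ℕ} (A : BlackBox K)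

/-- One time step of the algorithm with history `h` under the preference matrix `Q`: the law of
the duel that is played. -/
def duel (Q : Fin K → Fin K → unitInterval) (h : List (Duel K)) : PMF (Duel K) :=
  (A.select h).bind fun d => (bernoulli (Q d.1 d.2)).map fun x => (d, x)

/-- The law of the first `n` duels (most recent first) of the algorithm when it is run on its own
from time step `s` on, where `Q t` is the preference matrix of time step `t`. -/
def run (Q : ℕ → Fin K → Fin K → unitInterval) (s : ℕ) : ℕ → PMF (List (Duel K))
  | 0 => PMF.pure []
  | n + 1 => (run Q s n).bind fun h => (A.duel (Q (s + n)) h).map fun x => x :: h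

/-- The probability that the suspected Condorcet winner after `n` time steps is `a_i`, if the
algorithm is run in the stationary setting with preference matrix `Q`. -/
def suspectProb (Q : Fin K → Fin K → unitInterval) (n : ℕ) (i : Fin K) : ℝ :=
  (((A.run (fun _ => Q) 1 n).bind A.suspect) i).toReal

/-- The expected cumulative binary weak regret of the algorithm when it is run on its own for the
`n` time steps `s, …, s + n - 1`. -/
def expRegret {M T : ℕ} (E : Environment K M T) (s n : ℕ) : ℝ :=
  expect (A.run E.prefAt s n) fun h => E.cumRegret s (h.map Prod.fst)

end BlackBox

/-! ### DETECT -/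

/-- The orderings that DETECT uses: `arm τ I r` with `r < K - 1` is the `r`-th arm (counting from
zero) in the ordering of the arms other than `a_I` that is used if `a_I` is the suspected
Condorcet winner and `τ` the last detection time. -/
structure ArmOrder (K : ℕ) where
  arm : ℕ → Fin K → ℕ → Fin K
  bijOn : ∀ τ I, Set.BijOn (arm τ I) (Set.Iio (K - 1)) {j | j ≠ I}

/-- The parameters of DETECT: the number `capT` of time steps for which the black-box algorithm is
run, the window length `w`, the threshold `b`, the black-box algorithm and the orderings. -/
structure Detect (K : ℕ) where
  capT : ℕ
  w : ℕ
  b : ℝ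
  alg : BlackBox K
  ord : ArmOrder K

/-- The internal state of DETECT. The number `τ` is the time step of the last detection.
In the running phase, `h` contains the duels of the current instance of the black-box algorithm
(most recent first). In a detection phase, `I` is the suspected Condorcet winner and `X j` contains
the outcomes of all duels between `a_I` and `a_j` in this phase (most recent first). -/
inductive DetectState (K : ℕ) : Type
  | running (τ : ℕ) (h : List (Duel K))
  | detecting (τ : ℕ) (I : Fin K) (X : Fin K → List Bool)

namespace Detect

variable {K : ℕ} (D : Detect K)

/-- The changepoint test on the outcomes of one pair (most recent first): there are at least `w`
outcomes, and among the last `w` outcomes the numbers of wins in the older and in the newer half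
differ by more than `b`. -/
def alarm (X : List Bool) : Prop :=
  D.w ≤ X.length ∧
    D.b < |((((X.drop (D.w / 2)).take (D.w / 2)).count true : ℕ) : ℝ)
      - (((X.take (D.w / 2)).count true : ℕ) : ℝ)|

open Classical in
/-- A detection step at time `t` under the preference matrix `Q`: the joint law of the played pair
and the next state. -/
def detectionStep (Q : Fin K → Fin K → unitInterval) (t τ : ℕ) (I : Fin K)
    (X : Fin K → List Bool) : PMF (ArmPair K × DetectState K) :=
  let J : Fin K := D.ord.arm τ I ((t - τ - D.capT - 1) % (K - 1))
  (bernoulli (Q I J)).map fun x =>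
    ((I, J),
      if D.alarm (x :: X J) then DetectState.running t []
      else DetectState.detecting τ I (Function.update X J (x :: X J)))

/-- Time step `t` of DETECT under the preference matrix `Q`: the joint law of the played pair and
the next state, given the current state. -/
def step (Q : Fin K → Fin K → unitInterval) (t : ℕ) :
    DetectState K → PMF (ArmPair K × DetectState K)
  | DetectState.running τ h =>
      if t - τ ≤ D.capT then
        (D.alg.duel Q h).map fun x => (x.1, DetectState.running τ (x :: h))
      else
        (D.alg.suspect h).bind fun I => D.detectionStep Q t τ I fun _ => []
  | DetectState.detecting τ I X => D.detectionStep Q t τ I X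

/-- The joint law of the pairs (most recent first) that DETECT plays in the time steps `1, …, n`
and of its state afterwards, where `Q t` is the preference matrix of time step `t`. -/
def run (Q : ℕ → Fin K → Fin K → unitInterval) :
    ℕ → PMF (List (ArmPair K) × DetectState K)
  | 0 => PMF.pure ([], DetectState.running 0 [])
  | n + 1 => (run Q n).bind fun s =>
      (D.step (Q (n + 1)) (n + 1) s.2).map fun r => (r.1 :: s.1, r.2)

/-- The expected cumulative binary weak regret of DETECT up to the time horizon. -/
def expRegret {M T : ℕ} (E : Environment K M T) : ℝ :=
  expect (D.run E.prefAt T) fun s => E.cumRegret 1 s.1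

end Detect

end DuelingBandits

end

open scoped ENNReal

noncomputable section

namespace DuelingBandits

/-! Let h = w/2 and L = h(K-1), the time in which a detection phase plays h duels against every
other arm. The regret is studied through the expected remaining regret `costToGo`, which is bounded
by backward induction over the segments: a bound V for all restarts within L steps of the next
changepoint yields a bound for all restarts within L steps of the present one
(`costToGo_running_le`, iterated in `costToGo_le_sum`).

Consider such a restart. The segment is so long that the running phase stays inside it, hence it has
the law, and the regret, of the black box started at the beginning of the segment. A wrong suspect
has probability at most 1 - p and costs at most T. With the right suspect every pair contains the
Condorcet winner, so there is no regret before the changepoint unless a false alarm occurs. Each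
test raises one with probability at most ε = 2 exp(-2b²/w), at a cost of at most T. After the
changepoint some arm whose winning probability has changed meets the suspect h times within L steps.
Its window is then half old, half new, and the test stays silent with probability at most ε. So the
delay costs at most L, an alarm leads to a restart covered by V, and a missed alarm costs at most T.
One segment adds at most L + (1 - p)T + ε(T² + T) to the black box regret and V; the chosen b makes
ε = 2/T⁴.

Alarms stop a detection phase and thereby bias the recorded outcomes. All probabilities are
therefore computed for a phase that ignores alarms (`trackLaw`). Its schedule is deterministic, so
the outcomes against one arm are independent Bernoulli variables (`mean_trackLaw_apply`) and
Hoeffding's inequality applies (`prob_alarm_le`, `prob_not_alarm_le`). -/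

/-! ### Expectations of nonnegative functions -/

/-- The expected value in `[0, ∞]` of `F` under the discrete probability distribution `μ`. -/
def mean {α : Type} (μ : PMF α) (F : α → ℝ≥0∞) : ℝ≥0∞ := ∑' a, μ a * F a

section mean

variable {α β : Type}

theorem mean_pure (a : α) (F : α → ℝ≥0∞) : mean (PMF.pure a) F = F a := by
  classical
  simp only [mean, PMF.pure_apply]
  rw [tsum_eq_single a]
  · simp
  · intro b hb
    simp [hb]

theorem mean_bind (μ : PMF α) (k : α → PMF β) (F : β → ℝ≥0∞) :
    mean (μ.bind k) F = mean μ fun a => mean (k a) F := by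
  simp only [mean, PMF.bind_apply, ← ENNReal.tsum_mul_right, ← ENNReal.tsum_mul_left]
  rw [ENNReal.tsum_comm]
  simp only [mul_assoc]

theorem mean_map (μ : PMF α) (f : α → β) (F : β → ℝ≥0∞) :
    mean (μ.map f) F = mean μ fun a => F (f a) := by
  rw [PMF.map, mean_bind]
  simp only [Function.comp, mean_pure]

theorem mean_mono_support {μ : PMF α} {F G : α → ℝ≥0∞} (h : ∀ a ∈ μ.support, F a ≤ G a) :
    mean μ F ≤ mean μ G := by
  refine ENNReal.tsum_le_tsum fun a => ?_
  by_cases ha : a ∈ μ.support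
  · gcongr
    exact h a ha
  · rw [PMF.mem_support_iff, not_not] at ha
    simp [ha]

theorem mean_mono (μ : PMF α) {F G : α → ℝ≥0∞} (h : ∀ a, F a ≤ G a) : mean μ F ≤ mean μ G :=
  mean_mono_support fun a _ => h a

theorem mean_congr_support {μ : PMF α} {F G : α → ℝ≥0∞} (h : ∀ a ∈ μ.support, F a = G a) :
    mean μ F = mean μ G :=
  le_antisymm (mean_mono_support fun a ha => (h a ha).le)
    (mean_mono_support fun a ha => (h a ha).ge)

theorem mean_const (μ : PMF α) (c : ℝ≥0∞) : mean μ (fun _ => c) = c := by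
  rw [mean, ENNReal.tsum_mul_right, PMF.tsum_coe, one_mul]

theorem mean_add (μ : PMF α) (F G : α → ℝ≥0∞) :
    mean μ (fun a => F a + G a) = mean μ F + mean μ G := by
  simp only [mean, mul_add, ENNReal.tsum_add]

theorem mean_mul_const (μ : PMF α) (F : α → ℝ≥0∞) (c : ℝ≥0∞) :
    mean μ (fun a => F a * c) = mean μ F * c := by
  simp only [mean, ← mul_assoc, ENNReal.tsum_mul_right]

theorem mean_le_const {μ : PMF α} {F : α → ℝ≥0∞} {c : ℝ≥0∞} (h : ∀ a, F a ≤ c) :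
    mean μ F ≤ c :=
  (mean_mono μ h).trans_eq (mean_const μ c)

theorem expect_eq_toReal_mean (μ : PMF α) {f : α → ℝ} (hf : ∀ a, 0 ≤ f a) :
    expect μ f = (mean μ fun a => ENNReal.ofReal (f a)).toReal := by
  rw [mean, ENNReal.tsum_toReal_eq fun a => ENNReal.mul_ne_top (μ.apply_ne_top a)
    ENNReal.ofReal_ne_top]
  simp [expect, ENNReal.toReal_ofReal (hf _)]

end mean

open Classical in
/-- The indicator in `[0, ∞]` of a proposition. -/
def ind (q : Prop) : ℝ≥0∞ := if q then 1 else 0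

theorem ind_of {q : Prop} (h : q) : ind q = 1 := if_pos h

theorem ind_of_not {q : Prop} (h : ¬ q) : ind q = 0 := if_neg h

theorem ind_mono {q r : Prop} (h : q → r) : ind q ≤ ind r := by
  by_cases hq : q
  · rw [ind_of hq, ind_of (h hq)]
  · rw [ind_of_not hq]
    exact zero_le

/-! ### Concentration of independent Bernoulli outcomes -/

theorem mean_bernoulli (p : unitInterval) (F : Bool → ℝ≥0∞) :
    mean (bernoulli p) F
      = ENNReal.ofReal p * F true + ENNReal.ofReal (1 - p) * F false := by
  rw [mean, tsum_fintype, Fintype.sum_bool]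
  simp [bernoulli]

/-- Hoeffding's lemma for a Bernoulli distribution. -/
theorem bernoulli_exp_le (p s : ℝ) (h0 : 0 ≤ p) (h1 : p ≤ 1) :
    p * Real.exp (s * (1 - p)) + (1 - p) * Real.exp (s * (0 - p)) ≤ Real.exp (s ^ 2 / 8) := by
  open MeasureTheory ProbabilityTheory in
  -- The centred Bernoulli law lives on an interval of length 1, so its sub-Gaussian variance proxy
  -- is 1/4.
  let μ : Measure ℝ := ENNReal.ofReal p • Measure.dirac (1 - p)
    + ENNReal.ofReal (1 - p) • Measure.dirac (0 - p)
  have hμ : IsProbabilityMeasure μ := ⟨by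
    simp only [μ, Measure.add_apply, Measure.smul_apply, measure_univ, smul_eq_mul, mul_one]
    rw [← ENNReal.ofReal_add h0 (by linarith)]
    simp⟩
  have hint : ∀ f : ℝ → ℝ, ∫ x, f x ∂μ = p * f (1 - p) + (1 - p) * f (0 - p) := by
    intro f
    rw [integral_add_measure, integral_smul_measure, integral_smul_measure, integral_dirac,
      integral_dirac, ENNReal.toReal_ofReal h0, ENNReal.toReal_ofReal (by linarith)]
    · rfl
    · exact (integrable_dirac (by simp)).smul_measure ENNReal.ofReal_ne_top
    · exact (integrable_dirac (by simp)).smul_measure ENNReal.ofReal_ne_top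
  have hsub := hasSubgaussianMGF_of_mem_Icc_of_integral_eq_zero (μ := μ) (X := fun x : ℝ => x)
    (a := -p) (b := 1 - p) aemeasurable_id (by
      simp only [μ, ae_add_measure_iff]
      constructor
      · refine Measure.ae_smul_measure ?_ _
        rw [ae_dirac_eq]
        exact ⟨by linarith, by linarith⟩
      · refine Measure.ae_smul_measure ?_ _
        rw [ae_dirac_eq]
        exact ⟨by linarith, by linarith⟩) (by
      rw [hint]
      ring)
  have h := hsub.mgf_le s
  rw [mgf, hint] at h
  refine h.trans_eq ?_
  congr 1
  simp
  ring

/-- The law of a list of independent Bernoulli outcomes with the given success probabilities. -/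
def outcomeLaw : List unitInterval → PMF (List Bool)
  | [] => PMF.pure []
  | p :: ps => (outcomeLaw ps).bind fun H => (bernoulli p).map fun x => x :: H

theorem length_of_mem_support_outcomeLaw (ps : List unitInterval) :
    ∀ H ∈ (outcomeLaw ps).support, H.length = ps.length := by
  induction ps with
  | nil =>
    intro H hH
    simp only [outcomeLaw, PMF.support_pure, Set.mem_singleton_iff] at hH
    simp [hH]
  | cons p ps ih =>
    intro H hH
    simp only [outcomeLaw, PMF.mem_support_bind_iff, PMF.mem_support_map_iff] at hH
    obtain ⟨H', hH', x, -, rfl⟩ := hH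
    simp [ih H' hH']

/-- The numerical value of the `i`-th outcome of a list. -/
def outcome (H : List Bool) (i : ℕ) : ℝ := if H.getD i false then 1 else 0

/-- The deviation from its mean of a weighted sum of the first `n` outcomes. -/
def deviation (c : ℕ → ℝ) (n : ℕ) (ps : List unitInterval) (H : List Bool) : ℝ :=
  ∑ i ∈ Finset.range n, c i * (outcome H i - (ps.getD i 0 : unitInterval))

/-- Independence lets Hoeffding's lemma be applied to one outcome at a time. The number n may exceed
the length of the list: missing outcomes and missing probabilities both default to 0 and contribute
no deviation. -/
theorem mean_exp_deviation_le (ps : List unitInterval) :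
    ∀ (c : ℕ → ℝ) (n : ℕ),
      mean (outcomeLaw ps) (fun H => ENNReal.ofReal (Real.exp (deviation c n ps H)))
        ≤ ENNReal.ofReal (Real.exp ((∑ i ∈ Finset.range n, c i ^ 2) / 8)) := by
  induction ps with
  | nil =>
    intro c n
    rw [outcomeLaw, mean_pure]
    refine ENNReal.ofReal_le_ofReal (Real.exp_le_exp.2 ?_)
    have : deviation c n [] [] = 0 := by simp [deviation, outcome]
    rw [this]
    positivity
  | cons p ps ih =>
    intro c n
    cases n with
    | zero => simp [deviation, mean_const]
    | succ n =>
      rw [outcomeLaw, mean_bind]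
      have hdev : ∀ x H, deviation c (n + 1) (p :: ps) (x :: H)
          = deviation (fun i => c (i + 1)) n ps H + c 0 * ((if x then 1 else 0) - (p : ℝ)) := by
        intro x H
        simp [deviation, outcome, Finset.sum_range_succ']
      have hstep : ∀ H, mean ((bernoulli p).map fun x => x :: H)
          (fun H => ENNReal.ofReal (Real.exp (deviation c (n + 1) (p :: ps) H)))
          ≤ ENNReal.ofReal (Real.exp (deviation (fun i => c (i + 1)) n ps H))
            * ENNReal.ofReal (Real.exp (c 0 ^ 2 / 8)) := by
        intro H
        have h0 : (0 : ℝ) ≤ p := p.2.1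
        have h1 : (0 : ℝ) ≤ 1 - (p : ℝ) := sub_nonneg.mpr p.2.2
        rw [mean_map, mean_bernoulli, hdev, hdev, Real.exp_add, Real.exp_add,
          ← ENNReal.ofReal_mul h0, ← ENNReal.ofReal_mul h1,
          ← ENNReal.ofReal_add (by positivity) (by positivity),
          ← ENNReal.ofReal_mul (by positivity)]
        refine ENNReal.ofReal_le_ofReal ?_
        have h := bernoulli_exp_le p (c 0) h0 p.2.2
        have h' := mul_le_mul_of_nonneg_left h
          (Real.exp_pos (deviation (fun i => c (i + 1)) n ps H)).le
        refine le_trans (le_of_eq ?_) h'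
        simp
        ring
      refine (mean_mono _ hstep).trans ?_
      rw [mean_mul_const]
      refine (mul_le_mul_left (ih _ n) _).trans ?_
      rw [← ENNReal.ofReal_mul (by positivity), ← Real.exp_add, Finset.sum_range_succ']
      refine le_of_eq ?_
      ring_nf

theorem prob_le_deviation_le (ps : List unitInterval) {c : ℕ → ℝ} (hc : ∀ i, c i ^ 2 = 1)
    {n : ℕ} (hn : 0 < n) {a : ℝ} (ha : 0 ≤ a) :
    mean (outcomeLaw ps) (fun H => ind (a ≤ deviation c n ps H))
      ≤ ENNReal.ofReal (Real.exp (-(2 * a ^ 2 / n))) := by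
  have hn' : (0 : ℝ) < n := by exact_mod_cast hn
  -- Chernoff's method: s = 4a/n minimises s²n/8 - sa, with value -2a²/n.
  have hs : 0 ≤ 4 * a / n := by positivity
  set s : ℝ := 4 * a / n with hsdef
  have hpt : ∀ H, ind (a ≤ deviation c n ps H)
      ≤ ENNReal.ofReal (Real.exp (deviation (fun i => s * c i) n ps H))
        * ENNReal.ofReal (Real.exp (-(s * a))) := by
    intro H
    have hd : deviation (fun i => s * c i) n ps H = s * deviation c n ps H := by
      simp [deviation, Finset.mul_sum, mul_assoc]
    by_cases h : a ≤ deviation c n ps H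
    · rw [ind_of h, ← ENNReal.ofReal_mul (by positivity), ← Real.exp_add, hd,
        ENNReal.one_le_ofReal, Real.one_le_exp_iff]
      have := mul_le_mul_of_nonneg_left h hs
      linarith
    · rw [ind_of_not h]
      exact zero_le
  refine (mean_mono _ hpt).trans ?_
  rw [mean_mul_const]
  refine (mul_le_mul_left (mean_exp_deviation_le ps _ n) _).trans ?_
  rw [← ENNReal.ofReal_mul (by positivity), ← Real.exp_add]
  refine ENNReal.ofReal_le_ofReal (Real.exp_le_exp.2 (le_of_eq ?_))
  simp only [mul_pow, hc, mul_one, Finset.sum_const, Finset.card_range, nsmul_eq_mul]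
  rw [hsdef]
  field_simp
  ring

/-- Hoeffding's inequality for independent Bernoulli outcomes. -/
theorem prob_le_abs_deviation_le (ps : List unitInterval) {c : ℕ → ℝ} (hc : ∀ i, c i ^ 2 = 1)
    {n : ℕ} (hn : 0 < n) {a : ℝ} (ha : 0 ≤ a) :
    mean (outcomeLaw ps) (fun H => ind (a ≤ |deviation c n ps H|))
      ≤ ENNReal.ofReal (2 * Real.exp (-(2 * a ^ 2 / n))) := by
  have hneg : ∀ H, deviation (fun i => -c i) n ps H = -deviation c n ps H := by
    intro H
    simp [deviation]
  have hpt : ∀ H, ind (a ≤ |deviation c n ps H|)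
      ≤ ind (a ≤ deviation c n ps H) + ind (a ≤ deviation (fun i => -c i) n ps H) := by
    intro H
    by_cases h : a ≤ |deviation c n ps H|
    · rw [ind_of h]
      rcases le_abs.1 h with h | h
      · rw [ind_of h]
        exact le_self_add
      · rw [hneg, ind_of h]
        exact le_add_self
    · rw [ind_of_not h]
      exact zero_le
  refine (mean_mono _ hpt).trans ?_
  rw [mean_add, two_mul, ENNReal.ofReal_add (by positivity) (by positivity)]
  exact add_le_add (prob_le_deviation_le ps hc hn ha)
    (prob_le_deviation_le ps (by simpa using hc) hn ha)

theorem count_take_eq_sum (H : List Bool) (n : ℕ) :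
    (((H.take n).count true : ℕ) : ℝ) = ∑ i ∈ Finset.range n, outcome H i := by
  induction H generalizing n with
  | nil => simp [outcome]
  | cons x H ih =>
    cases n with
    | zero => simp
    | succ n =>
      rw [Finset.sum_range_succ', List.take_succ_cons, List.count_cons]
      push_cast
      rw [ih]
      simp [outcome]

theorem outcome_drop (H : List Bool) (n i : ℕ) : outcome (H.drop n) i = outcome H (n + i) := by
  simp [outcome, List.getD_eq_getElem?_getD]

/-- The signs with which outcomes enter the test statistic with half window length `h`. -/
def windowSign (h i : ℕ) : ℝ := if i < h then -1 else 1

theorem windowSign_sq (h i : ℕ) : windowSign h i ^ 2 = 1 := by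
  unfold windowSign
  split_ifs <;> norm_num

theorem sum_windowSign_mul (h : ℕ) (f : ℕ → ℝ) :
    ∑ i ∈ Finset.range (h + h), windowSign h i * f i
      = ∑ i ∈ Finset.range h, f (h + i) - ∑ i ∈ Finset.range h, f i := by
  rw [Finset.sum_range_add, add_comm, sub_eq_add_neg, ← Finset.sum_neg_distrib]
  congr 1
  · exact Finset.sum_congr rfl fun i _ => by simp [windowSign]
  · refine Finset.sum_congr rfl fun i hi => ?_
    simp [windowSign, Finset.mem_range.1 hi]

/-- Splits the test statistic into noise, controlled by Hoeffding, and drift. The drift vanishes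
without a change and is h times the change if the two halves lie on different sides of it. -/
theorem count_sub_count_eq (h : ℕ) (ps : List unitInterval) (H : List Bool) :
    ((((H.drop h).take h).count true : ℕ) : ℝ) - (((H.take h).count true : ℕ) : ℝ)
      = deviation (windowSign h) (h + h) ps H
        + (∑ i ∈ Finset.range h, ((ps.getD (h + i) 0 : unitInterval) : ℝ)
          - ∑ i ∈ Finset.range h, ((ps.getD i 0 : unitInterval) : ℝ)) := by
  rw [deviation, sum_windowSign_mul, count_take_eq_sum, count_take_eq_sum,
    Finset.sum_sub_distrib, Finset.sum_sub_distrib]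
  simp only [outcome_drop]
  ring


/-! ### Regret -/

namespace Environment

variable {K M T : ℕ} (E : Environment K M T)

theorem one_le_M {K M T : ℕ} (E : Environment K M T) (hT : 2 ≤ T) : 1 ≤ M := by
  by_contra h
  obtain rfl : M = 0 := by omega
  have h0 := E.ν_zero
  rw [E.ν_last] at h0
  omega

theorem ν_mono {i j : ℕ} (hij : i ≤ j) (hj : j ≤ M) : E.ν i ≤ E.ν j := by
  induction j, hij using Nat.le_induction with
  | base => rfl
  | succ j _ ih => exact (ih (by omega)).trans (E.ν_lt j (by omega)).le

theorem one_le_seg (t : ℕ) : 1 ≤ E.seg t := Nat.le_add_right 1 _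

theorem seg_le (hM : 1 ≤ M) (t : ℕ) : E.seg t ≤ M := by
  have h := Finset.card_filter_le (Finset.Icc 1 (M - 1)) fun m => E.ν m ≤ t
  rw [Nat.card_Icc] at h
  unfold seg
  omega

theorem seg_eq {m t : ℕ} (h1 : 1 ≤ m) (hm : m ≤ M) (hl : E.ν (m - 1) ≤ t) (hu : t < E.ν m) :
    E.seg t = m := by
  have hfilter : ((Finset.Icc 1 (M - 1)).filter fun i => E.ν i ≤ t) = Finset.Icc 1 (m - 1) := by
    ext i
    simp only [Finset.mem_filter, Finset.mem_Icc]
    constructor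
    · rintro ⟨⟨hi1, hi2⟩, hi⟩
      refine ⟨hi1, ?_⟩
      by_contra hlt
      have := E.ν_mono (i := m) (j := i) (by omega) (by omega)
      omega
    · rintro ⟨hi1, hi2⟩
      exact ⟨⟨hi1, by omega⟩, (E.ν_mono hi2 (by omega)).trans hl⟩
  rw [seg, hfilter, Nat.card_Icc]
  omega

theorem P_self {m : ℕ} (h1 : 1 ≤ m) (hm : m ≤ M) (i : Fin K) : (E.P m i i : ℝ) = 1 / 2 := by
  linarith [E.P_add m h1 hm i i]

theorem gap_nonneg {m : ℕ} (h1 : 1 ≤ m) (hm : m ≤ M) (i : Fin K) : 0 ≤ E.gap m i := by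
  unfold gap
  by_cases h : i = E.star m
  · rw [h, E.P_self h1 hm, sub_self]
  · linarith [E.star_beats m h1 hm i h]

theorem binWeakRegret_nonneg {m : ℕ} (h1 : 1 ≤ m) (hm : m ≤ M) (d : ArmPair K) :
    0 ≤ E.binWeakRegret m d := by
  unfold binWeakRegret
  exact_mod_cast Int.ceil_nonneg (le_min (E.gap_nonneg h1 hm d.1) (E.gap_nonneg h1 hm d.2))

theorem binWeakRegret_le_one (m : ℕ) (d : ArmPair K) : E.binWeakRegret m d ≤ 1 := by
  have h : ⌈E.weakRegret m d⌉ ≤ 1 := by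
    refine Int.ceil_le.2 ((min_le_left _ _).trans ?_)
    have := (E.P m (E.star m) d.1).2.2
    unfold gap
    push_cast
    linarith
  unfold binWeakRegret
  exact_mod_cast h

theorem binWeakRegret_star {m : ℕ} (h1 : 1 ≤ m) (hm : m ≤ M) (j : Fin K) :
    E.binWeakRegret m (E.star m, j) = 0 := by
  have hz : E.gap m (E.star m) = 0 := by rw [gap, E.P_self h1 hm, sub_self]
  rw [binWeakRegret, weakRegret, hz, min_eq_left (E.gap_nonneg h1 hm j)]
  simp

/-- The binary weak regret at time `t` as an extended nonnegative number. -/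
def regret (t : ℕ) (d : ArmPair K) : ℝ≥0∞ := ENNReal.ofReal (E.binWeakRegret (E.seg t) d)

theorem regret_le_one (t : ℕ) (d : ArmPair K) : E.regret t d ≤ 1 :=
  ENNReal.ofReal_le_one.2 (E.binWeakRegret_le_one _ d)

theorem regret_star (hM : 1 ≤ M) (t : ℕ) (j : Fin K) :
    E.regret t (E.star (E.seg t), j) = 0 := by
  rw [regret, E.binWeakRegret_star (E.one_le_seg t) (E.seg_le hM t), ENNReal.ofReal_zero]

theorem cumRegret_nonneg (hM : 1 ≤ M) (s : ℕ) (h : List (ArmPair K)) : 0 ≤ E.cumRegret s h := by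
  induction h with
  | nil => exact le_rfl
  | cons d h ih =>
    exact add_nonneg (E.binWeakRegret_nonneg (E.one_le_seg _) (E.seg_le hM _) d) ih

theorem ofReal_cumRegret_cons (hM : 1 ≤ M) (s : ℕ) (d : ArmPair K) (h : List (ArmPair K)) :
    ENNReal.ofReal (E.cumRegret s (d :: h))
      = E.regret (s + h.length) d + ENNReal.ofReal (E.cumRegret s h) :=
  ENNReal.ofReal_add (E.binWeakRegret_nonneg (E.one_le_seg _) (E.seg_le hM _) d)
    (E.cumRegret_nonneg hM s h)

theorem cumRegret_le_length (s : ℕ) (h : List (ArmPair K)) : E.cumRegret s h ≤ h.length := by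
  induction h with
  | nil => simp [cumRegret]
  | cons d h ih =>
    have := E.binWeakRegret_le_one (E.seg (s + h.length)) d
    simp only [cumRegret, List.length_cons]
    push_cast
    linarith

theorem cumRegret_congr {s s' : ℕ} (h : List (ArmPair K))
    (hseg : ∀ i < h.length, E.seg (s + i) = E.seg (s' + i)) :
    E.cumRegret s h = E.cumRegret s' h := by
  induction h with
  | nil => rfl
  | cons d h ih =>
    simp only [List.length_cons] at hseg
    rw [cumRegret, cumRegret, hseg _ (Nat.lt_succ_self _), ih fun i hi => hseg i (by omega)]

end Environment

/-! ### The black-box algorithm on its own -/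

namespace BlackBox

variable {K : ℕ} (A : BlackBox K)

theorem run_congr {Q Q' : ℕ → Fin K → Fin K → unitInterval} {s s' n : ℕ}
    (h : ∀ i < n, Q (s + i) = Q' (s' + i)) : A.run Q s n = A.run Q' s' n := by
  induction n with
  | zero => rfl
  | succ n ih => rw [run, run, ih fun i hi => h i (by omega), h n (Nat.lt_succ_self n)]

theorem length_of_mem_support_run (Q : ℕ → Fin K → Fin K → unitInterval) (s n : ℕ) :
    ∀ h ∈ (A.run Q s n).support, h.length = n := by
  induction n with
  | zero =>
    intro h hh
    simp only [run, PMF.support_pure, Set.mem_singleton_iff] at hh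
    simp [hh]
  | succ n ih =>
    intro h hh
    simp only [run, PMF.mem_support_bind_iff, PMF.mem_support_map_iff] at hh
    obtain ⟨h', hh', x, -, rfl⟩ := hh
    simp [ih h' hh']

variable {M T : ℕ} (E : Environment K M T)

theorem ofReal_expRegret (hM : 1 ≤ M) (s n : ℕ) :
    ENNReal.ofReal (A.expRegret E s n)
      = mean (A.run E.prefAt s n) fun h => ENNReal.ofReal (E.cumRegret s (h.map Prod.fst)) := by
  rw [expRegret, expect_eq_toReal_mean _ fun h => E.cumRegret_nonneg hM s _,
    ENNReal.ofReal_toReal]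
  refine ne_top_of_le_ne_top (ENNReal.natCast_ne_top n) ?_
  rw [← mean_const (A.run E.prefAt s n) (n : ℝ≥0∞)]
  refine mean_mono_support fun h hh => ?_
  rw [← ENNReal.ofReal_natCast]
  refine ENNReal.ofReal_le_ofReal ((E.cumRegret_le_length s _).trans_eq ?_)
  rw [List.length_map, A.length_of_mem_support_run _ _ _ h hh]

theorem expRegret_nonneg (hM : 1 ≤ M) (s n : ℕ) : 0 ≤ A.expRegret E s n := by
  rw [expRegret, expect_eq_toReal_mean _ fun h => E.cumRegret_nonneg hM s _]
  exact ENNReal.toReal_nonneg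

theorem mean_ind_suspect_ne_le (Q : Fin K → Fin K → unitInterval) (n : ℕ) (i : Fin K) {p : ℝ}
    (hp : p ≤ A.suspectProb Q n i) :
    mean (A.run (fun _ => Q) 1 n) (fun h => mean (A.suspect h) fun I => ind (I ≠ i))
      ≤ ENNReal.ofReal (1 - p) := by
  rw [← mean_bind]
  unfold suspectProb at hp
  set μ := (A.run (fun _ => Q) 1 n).bind A.suspect
  have hsum : mean μ (fun I => ind (I ≠ i)) + mean μ (fun I => ind (I = i)) = 1 := by
    rw [← mean_add, ← mean_const μ 1]
    congr 1
    ext I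
    by_cases h : I = i <;> simp [ind, h]
  have hi : mean μ (fun I => ind (I = i)) = μ i := by
    rw [mean, tsum_eq_single i]
    · simp [ind]
    · intro b hb
      simp [ind, hb]
  rw [hi] at hsum
  have htop : mean μ (fun I => ind (I ≠ i)) ≠ ∞ := by
    intro h
    rw [h, top_add] at hsum
    exact ENNReal.top_ne_one hsum
  have hreal := congrArg ENNReal.toReal hsum
  rw [ENNReal.toReal_add htop (μ.apply_ne_top i), ENNReal.toReal_one] at hreal
  rw [← ENNReal.ofReal_toReal htop]
  exact ENNReal.ofReal_le_ofReal (by linarith)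

end BlackBox

/-! ### The expected remaining regret of DETECT -/

namespace Detect

variable {K M T : ℕ} (D : Detect K) (E : Environment K M T)

/-- The expected regret of DETECT in the `k` time steps after time `n`, given its state at
time `n`. -/
def costToGo : ℕ → ℕ → DetectState K → ℝ≥0∞
  | 0, _, _ => 0
  | k + 1, n, s => mean (D.step (E.prefAt (n + 1)) (n + 1) s) fun r =>
      E.regret (n + 1) r.1 + costToGo k (n + 1) r.2

theorem costToGo_le (k : ℕ) : ∀ (n : ℕ) (s : DetectState K), D.costToGo E k n s ≤ k := by
  induction k with
  | zero => intro n s; simp [costToGo]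
  | succ k ih =>
    intro n s
    refine mean_le_const fun r => ?_
    rw [Nat.cast_succ, add_comm]
    exact add_le_add (ih _ _) (E.regret_le_one _ _)

theorem length_of_mem_support_run (Q : ℕ → Fin K → Fin K → unitInterval) (n : ℕ) :
    ∀ s ∈ (D.run Q n).support, s.1.length = n := by
  induction n with
  | zero =>
    intro s hs
    simp only [run, PMF.support_pure, Set.mem_singleton_iff] at hs
    simp [hs]
  | succ n ih =>
    intro s hs
    simp only [run, PMF.mem_support_bind_iff, PMF.mem_support_map_iff] at hs
    obtain ⟨s', hs', r, -, rfl⟩ := hs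
    simp [ih s' hs']

/-- Past regret plus expected remaining regret is conserved in the mean, which turns the forward
definition of the regret into the backward recursion of `costToGo`. -/
theorem mean_run_add_costToGo (hM : 1 ≤ M) (n k : ℕ) :
    mean (D.run E.prefAt n) (fun s =>
        ENNReal.ofReal (E.cumRegret 1 s.1) + D.costToGo E k n s.2)
      = D.costToGo E (n + k) 0 (DetectState.running 0 []) := by
  induction n generalizing k with
  | zero => simp [run, mean_pure, Environment.cumRegret]
  | succ n ih =>
    rw [show n + 1 + k = n + (k + 1) by omega, ← ih (k + 1), run, mean_bind]
    refine mean_congr_support fun s hs => ?_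
    rw [mean_map, costToGo, ← mean_const (D.step (E.prefAt (n + 1)) (n + 1) s.2)
      (ENNReal.ofReal (E.cumRegret 1 s.1)), ← mean_add]
    congr 1
    ext r
    rw [E.ofReal_cumRegret_cons hM, D.length_of_mem_support_run _ _ s hs, add_comm 1 n]
    ring

theorem expRegret_eq (hM : 1 ≤ M) :
    D.expRegret E = (D.costToGo E T 0 (DetectState.running 0 [])).toReal := by
  rw [expRegret, expect_eq_toReal_mean _ fun s => E.cumRegret_nonneg hM 1 _]
  have h := D.mean_run_add_costToGo E hM T 0
  simp only [costToGo, add_zero] at h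
  rw [h]

theorem costToGo_running_eq_mean (hM : 1 ≤ M) (τ k : ℕ) {n : ℕ} (hn : n ≤ D.capT) :
    D.costToGo E (n + k) τ (DetectState.running τ [])
      = mean (D.alg.run E.prefAt (τ + 1) n) fun h =>
          ENNReal.ofReal (E.cumRegret (τ + 1) (h.map Prod.fst))
            + D.costToGo E k (τ + n) (DetectState.running τ h) := by
  induction n generalizing k with
  | zero => simp [BlackBox.run, mean_pure, Environment.cumRegret]
  | succ n ih =>
    rw [show n + 1 + k = n + (k + 1) by omega, ih (k + 1) (by omega), BlackBox.run, mean_bind]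
    refine mean_congr_support fun h hh => ?_
    have hlen := D.alg.length_of_mem_support_run _ _ _ h hh
    rw [costToGo, step, if_pos (by omega), mean_map, mean_map,
      ← mean_const (D.alg.duel (E.prefAt (τ + 1 + n)) h)
      (ENNReal.ofReal (E.cumRegret (τ + 1) (h.map Prod.fst))),
      show τ + n + 1 = τ + 1 + n by omega, ← mean_add]
    congr 1
    ext x
    rw [List.map_cons, E.ofReal_cumRegret_cons hM, List.length_map, hlen,
      show τ + (n + 1) = τ + 1 + n by omega]
    ring

theorem costToGo_running_eq_mean_suspect {τ n : ℕ} (k : ℕ) (hn : τ + D.capT ≤ n)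
    (h : List (Duel K)) :
    D.costToGo E k n (DetectState.running τ h)
      = mean (D.alg.suspect h) fun I =>
          D.costToGo E k n (DetectState.detecting τ I fun _ => []) := by
  cases k with
  | zero => simp [costToGo, mean_const]
  | succ k =>
    -- The suspect is drawn together with the first detection duel. Drawing it beforehand and
    -- entering a detection phase with empty lists gives the same law.
    rw [costToGo, step, if_neg (by omega), mean_bind]
    rfl

/-- The outcome lists of a detection phase after a further outcome `x` against `a_j`. -/
def record (X : Fin K → List Bool) (j : Fin K) (x : Bool) : Fin K → List Bool :=
  Function.update X j (x :: X j)

/-- The arm that `a_I` meets in the duel number `N` (counting from zero) of a detection phase. -/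
def opponent (τ : ℕ) (I : Fin K) (N : ℕ) : Fin K := D.ord.arm τ I (N % (K - 1))

/-- The winning probability of `a_I` in the duel number `N` of a detection phase. -/
def winProb (τ : ℕ) (I : Fin K) (N : ℕ) : unitInterval :=
  E.prefAt (τ + D.capT + N + 1) I (D.opponent τ I N)

open Classical in
theorem costToGo_detecting (τ : ℕ) (I : Fin K) (k N : ℕ) (X : Fin K → List Bool) :
    D.costToGo E (k + 1) (τ + D.capT + N) (DetectState.detecting τ I X)
      = mean (bernoulli (D.winProb E τ I N)) fun x =>
          E.regret (τ + D.capT + N + 1) (I, D.opponent τ I N)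
          + D.costToGo E k (τ + D.capT + N + 1)
            (if D.alarm (x :: X (D.opponent τ I N)) then
              DetectState.running (τ + D.capT + N + 1) []
            else DetectState.detecting τ I (record X (D.opponent τ I N) x)) := by
  rw [costToGo, step, detectionStep]
  simp only [mean_map, show τ + D.capT + N + 1 - τ - D.capT - 1 = N by omega]
  rfl

end Detect


namespace Detect

variable {K M T : ℕ} (D : Detect K) (E : Environment K M T)

/-! ### The changepoint test -/

theorem prob_alarm_le {h : ℕ} (hh : 0 < h) (hw : D.w = h + h) (hb : 0 ≤ D.b) (a : ℕ)
    (p : unitInterval) :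
    mean (outcomeLaw (List.replicate a p)) (fun H => ind (D.alarm H))
      ≤ ENNReal.ofReal (2 * Real.exp (-(2 * D.b ^ 2 / D.w))) := by
  refine le_trans (mean_mono_support fun H hH => ?_)
    (prob_le_abs_deviation_le (List.replicate a p) (windowSign_sq h) (n := D.w) (by omega) hb)
  refine ind_mono fun halarm => ?_
  obtain ⟨hlen, hgt⟩ := halarm
  rw [length_of_mem_support_outcomeLaw _ H hH, List.length_replicate] at hlen
  have hhalf : D.w / 2 = h := by omega
  rw [hhalf, count_sub_count_eq h (List.replicate a p) H] at hgt
  have hsum : ∀ k ≤ h, ∑ i ∈ Finset.range h,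
      (((List.replicate a p).getD (k + i) 0 : unitInterval) : ℝ) = h * p := by
    intro k hk
    rw [Finset.sum_congr rfl (g := fun _ => (p : ℝ)), Finset.sum_const, Finset.card_range,
      nsmul_eq_mul]
    intro i hi
    have := Finset.mem_range.1 hi
    rw [List.getD_eq_getElem?_getD, List.getElem?_replicate_of_lt (by omega), Option.getD_some]
  have h0 := hsum 0 (Nat.zero_le _)
  simp only [zero_add] at h0
  rw [hsum h le_rfl, h0, sub_self, add_zero, ← hw] at hgt
  exact hgt.le

/-- The drift is at least 2b in absolute value, so a statistic of size at most b forces a deviation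
of size at least b. Lists are newest first: q is the probability after the change, p the one before.
-/
theorem prob_not_alarm_le {h : ℕ} (hh : 0 < h) (hw : D.w = h + h) (hb : 0 ≤ D.b) {a : ℕ}
    (ha : h ≤ a) {p q : unitInterval} (hpq : 2 * D.b ≤ h * |(p : ℝ) - q|) :
    mean (outcomeLaw (List.replicate h q ++ List.replicate a p)) (fun H => ind (¬ D.alarm H))
      ≤ ENNReal.ofReal (2 * Real.exp (-(2 * D.b ^ 2 / D.w))) := by
  refine le_trans (mean_mono_support fun H hH => ?_)
    (prob_le_abs_deviation_le (List.replicate h q ++ List.replicate a p) (windowSign_sq h)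
      (n := D.w) (by omega) hb)
  refine ind_mono fun halarm => ?_
  have hlen := length_of_mem_support_outcomeLaw _ H hH
  rw [List.length_append, List.length_replicate, List.length_replicate] at hlen
  have hhalf : D.w / 2 = h := by omega
  have hle : ¬ _ := fun hlt => halarm ⟨by omega, hlt⟩
  rw [not_lt, hhalf, count_sub_count_eq h (List.replicate h q ++ List.replicate a p) H, ← hw] at hle
  have hsum0 : ∑ i ∈ Finset.range h,
      (((List.replicate h q ++ List.replicate a p).getD i 0 : unitInterval) : ℝ) = h * q := by
    rw [Finset.sum_congr rfl (g := fun _ => (q : ℝ)), Finset.sum_const, Finset.card_range,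
      nsmul_eq_mul]
    intro i hi
    have := Finset.mem_range.1 hi
    rw [List.getD_eq_getElem?_getD, List.getElem?_append_left (by simpa using this),
      List.getElem?_replicate_of_lt this, Option.getD_some]
  have hsum1 : ∑ i ∈ Finset.range h,
      (((List.replicate h q ++ List.replicate a p).getD (h + i) 0 : unitInterval) : ℝ)
        = h * p := by
    rw [Finset.sum_congr rfl (g := fun _ => (p : ℝ)), Finset.sum_const, Finset.card_range,
      nsmul_eq_mul]
    intro i hi
    have := Finset.mem_range.1 hi
    rw [List.getD_eq_getElem?_getD, List.getElem?_append_right (by simp),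
      List.getElem?_replicate_of_lt (by simp; omega), Option.getD_some]
  rw [hsum0, hsum1, ← mul_sub] at hle
  have habs : |(h : ℝ) * ((p : ℝ) - q)| = h * |(p : ℝ) - q| := by
    rw [abs_mul, Nat.abs_cast]
  have htri := abs_sub_abs_le_abs_sub ((h : ℝ) * ((p : ℝ) - q))
    (-deviation (windowSign h) D.w (List.replicate h q ++ List.replicate a p) H)
  rw [abs_neg, sub_neg_eq_add, habs, add_comm ((h : ℝ) * _)] at htri
  linarith

/-! ### The schedule of a detection phase -/

theorem opponent_add_period (τ : ℕ) (I : Fin K) (N : ℕ) :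
    D.opponent τ I (N + (K - 1)) = D.opponent τ I N := by
  rw [opponent, opponent, Nat.add_mod_right]

/-- The number of duels against `a_j` among the duels `n, …, n + r - 1` of a detection phase. -/
def visits (τ : ℕ) (I j : Fin K) (n r : ℕ) : ℕ :=
  Nat.count (fun i => D.opponent τ I (n + i) = j) r

theorem visits_add (τ : ℕ) (I j : Fin K) (n r s : ℕ) :
    D.visits τ I j n (r + s) = D.visits τ I j n r + D.visits τ I j (n + r) s := by
  simp only [visits, Nat.count_add, add_assoc]

theorem visits_one (τ : ℕ) (I j : Fin K) (n : ℕ) :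
    D.visits τ I j n 1 = if D.opponent τ I n = j then 1 else 0 := by
  simp [visits, Nat.count_succ]

theorem visits_period {τ : ℕ} {I j : Fin K} (hj : j ≠ I) (n : ℕ) :
    D.visits τ I j n (K - 1) = 1 := by
  induction n with
  | zero =>
    obtain ⟨s, hs, hsj⟩ := (D.ord.bijOn τ I).surjOn hj
    rw [visits, Nat.count_eq_card_filter_range, Finset.card_eq_one]
    refine ⟨s, ?_⟩
    ext i
    simp only [Finset.mem_filter, Finset.mem_range, Finset.mem_singleton, zero_add]
    constructor
    · rintro ⟨hi, hij⟩
      rw [opponent, Nat.mod_eq_of_lt hi] at hij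
      exact (D.ord.bijOn τ I).injOn hi hs (hij.trans hsj.symm)
    · rintro rfl
      exact ⟨hs, by rw [opponent, Nat.mod_eq_of_lt hs, hsj]⟩
  -- Shifting the window by one drops duel n and gains duel n + (K - 1), which has the same
  -- opponent.
  | succ n ih =>
    have h1 := D.visits_add τ I j n 1 (K - 1)
    have h2 := D.visits_add τ I j n (K - 1) 1
    rw [add_comm (K - 1) 1, visits_one, opponent_add_period] at h2
    rw [visits_one] at h1
    omega

theorem visits_mul_period {τ : ℕ} {I j : Fin K} (hj : j ≠ I) (n h : ℕ) :
    D.visits τ I j n (h * (K - 1)) = h := by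
  induction h with
  | zero => simp [visits]
  | succ h ih => rw [Nat.succ_mul, visits_add, ih, D.visits_period hj]

theorem exists_visits_eq {τ : ℕ} {I j : Fin K} (hj : j ≠ I) (n : ℕ) {h : ℕ} (hh : 0 < h) :
    ∃ r, r + 1 ≤ h * (K - 1) ∧ D.visits τ I j n (r + 1) = h ∧ D.opponent τ I (n + r) = j := by
  classical
  -- For the least r with h visits, the last duel counted is against j. The test for j is thus run
  -- exactly when its newer half is filled.
  have hex : ∃ r, D.visits τ I j n r = h := ⟨_, D.visits_mul_period hj n h⟩
  have hspec := Nat.find_spec hex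
  have hle : Nat.find hex ≤ h * (K - 1) := Nat.find_min' hex (D.visits_mul_period hj n h)
  have hmin := fun r => Nat.find_min hex (m := r)
  generalize Nat.find hex = r at hspec hle hmin
  cases r with
  | zero =>
    simp [visits] at hspec
    omega
  | succ r =>
    refine ⟨r, hle, hspec, ?_⟩
    by_contra hne
    refine hmin r (Nat.lt_succ_self r) ?_
    rw [visits_add, visits_one, if_neg hne] at hspec
    exact hspec

/-! ### Detection without alarms -/

/-- The winning probabilities of `a_I` in its duels against `a_j` among the first `N` duels of a
detection phase, most recent first. -/
def winProbs (τ : ℕ) (I j : Fin K) : ℕ → List unitInterval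
  | 0 => []
  | N + 1 => if D.opponent τ I N = j then D.winProb E τ I N :: winProbs τ I j N
      else winProbs τ I j N

theorem winProbs_add {τ : ℕ} {I j : Fin K} {m : ℕ} (n r : ℕ)
    (hseg : ∀ i < r, E.seg (τ + D.capT + (n + i) + 1) = m) :
    D.winProbs E τ I j (n + r)
      = List.replicate (D.visits τ I j n r) (E.P m I j) ++ D.winProbs E τ I j n := by
  induction r with
  | zero => simp [visits]
  | succ r ih =>
    rw [← add_assoc, winProbs, ih fun i hi => hseg i (by omega), visits_add, visits_one]
    split_ifs with hj
    · rw [List.replicate_succ, List.cons_append, winProb, Environment.prefAt,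
        hseg r (Nat.lt_succ_self r), hj]
    · rfl

/-- The law of the outcome lists after the first `N` duels of a detection phase that is continued
in spite of alarms. -/
def trackLaw (τ : ℕ) (I : Fin K) : ℕ → PMF (Fin K → List Bool)
  | 0 => PMF.pure fun _ => []
  | N + 1 => (trackLaw τ I N).bind fun X =>
      (bernoulli (D.winProb E τ I N)).map (record X (D.opponent τ I N))

/-- Duels against other arms leave the list of `a_j` untouched, and which duels are against `a_j` is
deterministic. -/
theorem mean_trackLaw_apply (τ : ℕ) (I j : Fin K) (N : ℕ) (F : List Bool → ℝ≥0∞) :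
    mean (D.trackLaw E τ I N) (fun X => F (X j)) = mean (outcomeLaw (D.winProbs E τ I j N)) F := by
  induction N generalizing F with
  | zero => rw [trackLaw, winProbs, outcomeLaw, mean_pure, mean_pure]
  | succ N ih =>
    rw [trackLaw, winProbs, mean_bind]
    simp only [mean_map]
    split_ifs with hj
    · rw [outcomeLaw, mean_bind]
      simp only [mean_map]
      rw [← ih]
      simp only [record, hj, Function.update_self]
    · rw [← ih]
      simp only [record, Function.update_of_ne (Ne.symm hj), mean_const]

/-- Union bound over false alarms: each step charges T if its test fires, and then continues with
the phase that ignores alarms. Regret before the changepoint is zero by `hreg`. -/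
theorem costToGo_detecting_le_before {τ : ℕ} {I : Fin K} {n₁ : ℕ} {ε : ℝ≥0∞}
    (hreg : ∀ N < n₁, ∀ j, E.regret (τ + D.capT + N + 1) (I, j) = 0)
    (hε : ∀ N < n₁, mean (D.trackLaw E τ I (N + 1))
      (fun X => ind (D.alarm (X (D.opponent τ I N)))) ≤ ε)
    (k N : ℕ) (hN : N ≤ n₁) (hk : N + k ≤ T) :
    D.costToGo E (N + k) (τ + D.capT) (DetectState.detecting τ I fun _ => [])
      ≤ N * (ε * T) + mean (D.trackLaw E τ I N) fun X =>
          D.costToGo E k (τ + D.capT + N) (DetectState.detecting τ I X) := by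
  induction N generalizing k with
  | zero => simp [trackLaw, mean_pure]
  | succ N ih =>
    rw [show N + 1 + k = N + (k + 1) by omega]
    refine (ih (k + 1) (by omega) (by omega)).trans ?_
    have hstep : ∀ X, D.costToGo E (k + 1) (τ + D.capT + N) (DetectState.detecting τ I X)
        ≤ mean ((bernoulli (D.winProb E τ I N)).map (record X (D.opponent τ I N))) fun X' =>
            ind (D.alarm (X' (D.opponent τ I N))) * T
              + D.costToGo E k (τ + D.capT + N + 1) (DetectState.detecting τ I X') := by
      intro X
      rw [costToGo_detecting, mean_map]
      refine mean_mono _ fun x => ?_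
      rw [hreg N (by omega), zero_add]
      have hx : record X (D.opponent τ I N) x (D.opponent τ I N)
          = x :: X (D.opponent τ I N) := Function.update_self ..
      rw [hx]
      split_ifs with halarm
      · rw [ind_of halarm, one_mul]
        refine (D.costToGo_le E _ _ _).trans (le_trans ?_ le_self_add)
        exact_mod_cast (by omega : k ≤ T)
      · exact le_add_self
    refine (add_le_add_right (mean_mono _ hstep) _).trans ?_
    rw [← mean_bind]
    change _ + mean (D.trackLaw E τ I (N + 1)) _ ≤ _
    rw [mean_add, mean_mul_const, ← add_assoc, Nat.cast_succ, add_mul, one_mul]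
    refine add_le_add_left (add_le_add_right ?_ _) _
    gcongr
    exact hε N (by omega)

/-- The probability, given the outcome lists `X` after `N` duels, that the test for `a_j` does not
raise an alarm after `r` further duels of a detection phase that is continued in spite of
alarms. -/
def missProb (τ : ℕ) (I j : Fin K) : ℕ → ℕ → (Fin K → List Bool) → ℝ≥0∞
  | 0, _, X => ind (¬ D.alarm (X j))
  | r + 1, N, X => mean (bernoulli (D.winProb E τ I N)) fun x =>
      missProb τ I j r (N + 1) (record X (D.opponent τ I N) x)

theorem mean_missProb (τ : ℕ) (I j : Fin K) (r N : ℕ) :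
    mean (D.trackLaw E τ I N) (D.missProb E τ I j r N)
      = mean (D.trackLaw E τ I (N + r)) fun X => ind (¬ D.alarm (X j)) := by
  induction r generalizing N with
  | zero => rfl
  | succ r ih =>
    rw [show N + (r + 1) = N + 1 + r by omega, ← ih (N + 1), trackLaw, mean_bind]
    simp only [mean_map, missProb]

/-- Any alarm, of whichever arm, ends the phase after at most r steps of regret at most 1 and is
followed by a restart costing at most V. If none occurs, the last test was the one for `a_j` and it
stayed silent, an event whose probability is at most `missProb`. -/
theorem costToGo_detecting_le_after {τ : ℕ} {I j : Fin K} {V : ℝ≥0∞} (r : ℕ) :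
    ∀ (k N : ℕ) (X : Fin K → List Bool), r ≤ k → k ≤ T →
      (∀ i < r, D.costToGo E (k - i - 1) (τ + D.capT + N + i + 1)
        (DetectState.running (τ + D.capT + N + i + 1) []) ≤ V) →
      (r = 0 → ¬ D.alarm (X j)) →
      (∀ s, r = s + 1 → D.opponent τ I (N + s) = j) →
      D.costToGo E k (τ + D.capT + N) (DetectState.detecting τ I X)
        ≤ r + V + D.missProb E τ I j r N X * T := by
  induction r with
  | zero =>
    intro k N X _ hk _ h0 _
    rw [missProb, ind_of (h0 rfl), one_mul]
    exact ((D.costToGo_le E _ _ _).trans (by exact_mod_cast hk)).trans le_add_self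
  | succ r ih =>
    intro k N X hrk hk hV _ hs
    obtain ⟨k, rfl⟩ : ∃ k', k = k' + 1 := ⟨k - 1, by omega⟩
    rw [costToGo_detecting, missProb, ← mean_mul_const, ← mean_const
      (bernoulli (D.winProb E τ I N)) (((r + 1 : ℕ) : ℝ≥0∞) + V), ← mean_add]
    refine mean_mono _ fun x => ?_
    refine (add_le_add (E.regret_le_one _ _) ?_ : _ ≤ 1 + (r + V
      + D.missProb E τ I j r (N + 1) (record X (D.opponent τ I N) x) * T)).trans_eq
        (by push_cast; ring)
    split_ifs with halarm
    · refine (hV 0 (Nat.succ_pos r)).trans ?_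
      exact le_add_self.trans le_self_add
    · refine ih k (N + 1) _ (by omega) (by omega) (fun i hi => ?_) (fun hr => ?_)
        fun s hrs => ?_
      · have := hV (i + 1) (by omega)
        rwa [show k + 1 - (i + 1) - 1 = k - i - 1 by omega,
          show τ + D.capT + N + (i + 1) + 1 = τ + D.capT + (N + 1) + i + 1 by omega] at this
      · have hj := hs 0 (by omega)
        rw [add_zero] at hj
        rw [hj] at halarm ⊢
        rwa [record, Function.update_self]
      · rw [← hs (s + 1) (by omega)]
        congr 1
        omega

end Detect


/-! ### The cost of one segment and the induction over segments -/

namespace Detect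

variable {K M T : ℕ} (D : Detect K) (E : Environment K M T)

/-- A detection phase that starts early enough in segment `m` with the Condorcet winner costs, up
to the delay of the detection of the next changepoint and to the unlikely false or missing alarms,
no more than a restart shortly after that changepoint. -/
theorem costToGo_detecting_star_le {h m τ : ℕ} {V : ℝ≥0∞} (hh : 0 < h) (hw : D.w = h + h)
    (hb : 0 < D.b) (hM : 1 ≤ M)
    (hlen : ∀ i, 1 ≤ i → i ≤ M → D.capT + 3 * (h * (K - 1)) + E.ν (i - 1) ≤ E.ν i)
    (h1 : 1 ≤ m) (hm : m ≤ M)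
    (hchange : m < M → ∃ j, 2 * D.b
      ≤ h * |(E.P m (E.star m) j : ℝ) - E.P (m + 1) (E.star m) j|)
    (hV : m < M → ∀ t, E.ν m ≤ t → t + 1 ≤ E.ν m + h * (K - 1) →
      D.costToGo E (T - t) t (DetectState.running t []) ≤ V)
    (hτ : E.ν (m - 1) ≤ τ + 1) (hτ' : τ + 1 ≤ E.ν (m - 1) + h * (K - 1)) :
    D.costToGo E (T - (τ + D.capT)) (τ + D.capT)
        (DetectState.detecting τ (E.star m) fun _ => [])
      ≤ T * (ENNReal.ofReal (2 * Real.exp (-(2 * D.b ^ 2 / D.w))) * T)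
        + (((h * (K - 1) : ℕ) : ℝ≥0∞) + V
          + ENNReal.ofReal (2 * Real.exp (-(2 * D.b ^ 2 / D.w))) * T) := by
  set ε := ENNReal.ofReal (2 * Real.exp (-(2 * D.b ^ 2 / D.w)))
  set L := h * (K - 1) with hL
  have hlast := E.ν_last
  have hνm := hlen m h1 hm
  have hνM := E.ν_mono hm le_rfl
  -- Duel N takes place at time τ + capT + N + 1, so exactly the duels N < n₁ of this phase precede
  -- the changepoint.
  obtain ⟨n₁, hn₁⟩ : ∃ n₁, τ + D.capT + n₁ + 1 = E.ν m := ⟨E.ν m - 1 - τ - D.capT, by omega⟩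
  have hsegm : ∀ N < n₁, E.seg (τ + D.capT + N + 1) = m := fun N hN =>
    E.seg_eq h1 hm (by omega) (by omega)
  have hprobs : ∀ (j : Fin K) (N : ℕ), N ≤ n₁ → D.winProbs E τ (E.star m) j N
      = List.replicate (D.visits τ (E.star m) j 0 N) (E.P m (E.star m) j) := by
    intro j N hN
    have := D.winProbs_add E (τ := τ) (I := E.star m) (j := j) (m := m) 0 N fun i hi => by
      rw [zero_add]
      exact hsegm i (by omega)
    rw [zero_add] at this
    rw [this, winProbs, List.append_nil]
  have hbefore := D.costToGo_detecting_le_before E (τ := τ) (I := E.star m) (n₁ := n₁) (ε := ε)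
    (fun N hN j => by
      rw [← hsegm N hN]
      exact E.regret_star hM _ j)
    (fun N hN => by
      rw [D.mean_trackLaw_apply E τ _ _ (N + 1) fun H => ind (D.alarm H), hprobs _ _ (by omega)]
      exact D.prob_alarm_le hh hw hb.le _ _)
    (T - (τ + D.capT + n₁)) n₁ le_rfl (by omega)
  rw [show n₁ + (T - (τ + D.capT + n₁)) = T - (τ + D.capT) by omega] at hbefore
  refine hbefore.trans (add_le_add ?_ ?_)
  · gcongr
    omega
  rcases hm.lt_or_eq with hmM | rfl
  · obtain ⟨j, hj⟩ := hchange hmM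
    have hνm' := hlen (m + 1) (by omega) (by omega)
    rw [Nat.add_sub_cancel] at hνm'
    have hνM' := E.ν_mono (i := m + 1) hmM le_rfl
    -- An arm beats itself with probability 1/2 in both segments, so the change must concern another
    -- arm.
    have hjI : j ≠ E.star m := by
      rintro rfl
      have hz : (E.P (m + 1) (E.star m) (E.star m) : ℝ) = 1 / 2 :=
        E.P_self (by omega) (by omega) _
      rw [E.P_self h1 hm, hz] at hj
      simp at hj
      linarith
    obtain ⟨r, hrL, hr, hrj⟩ := D.exists_visits_eq (τ := τ) hjI n₁ hh
    rw [← hL] at hrL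
    have hafter : ∀ X, D.costToGo E (T - (τ + D.capT + n₁)) (τ + D.capT + n₁)
        (DetectState.detecting τ (E.star m) X)
        ≤ L + V + D.missProb E τ (E.star m) j (r + 1) n₁ X * T := by
      intro X
      refine (D.costToGo_detecting_le_after E (j := j) (V := V) (r + 1) _ n₁ X (by omega) (by omega)
        (fun i hi => ?_) (fun h0 => absurd h0 (Nat.succ_ne_zero r)) fun s hs => ?_).trans ?_
      · rw [show T - (τ + D.capT + n₁) - i - 1 = T - (τ + D.capT + n₁ + i + 1) by omega]
        exact hV hmM _ (by omega) (by omega)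
      · obtain rfl : r = s := by omega
        exact hrj
      · gcongr
    refine (mean_mono _ hafter).trans ?_
    rw [mean_add, mean_const, mean_mul_const, D.mean_missProb]
    gcongr
    rw [D.mean_trackLaw_apply E τ _ j _ fun H => ind (¬ D.alarm H),
      D.winProbs_add E (m := m + 1) n₁ (r + 1) fun i hi =>
        E.seg_eq (by omega) (by omega) (by rw [Nat.add_sub_cancel]; omega) (by omega),
      hr, hprobs j n₁ le_rfl]
    refine D.prob_not_alarm_le hh hw hb.le ?_ hj
    -- At least L duels precede the changepoint, which fills the older half of the window with
    -- outcomes from segment m.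
    obtain ⟨s, rfl⟩ : ∃ s, n₁ = L + s := ⟨n₁ - L, by omega⟩
    rw [D.visits_add, hL, D.visits_mul_period hjI]
    exact Nat.le_add_right _ _
  -- In the last segment the "changepoint" is T + 1 and no time remains.
  · rw [show T - (τ + D.capT + n₁) = 0 by omega]
    refine (mean_le_const fun X => ?_).trans zero_le
    rfl

/-- The cost of one segment. -/
theorem costToGo_running_le {h m τ : ℕ} {V : ℝ≥0∞} {p : ℝ} (hh : 0 < h) (hw : D.w = h + h)
    (hb : 0 < D.b) (hM : 1 ≤ M)
    (hlen : ∀ i, 1 ≤ i → i ≤ M → D.capT + 3 * (h * (K - 1)) + E.ν (i - 1) ≤ E.ν i)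
    (h1 : 1 ≤ m) (hm : m ≤ M)
    (hchange : m < M → ∃ j, 2 * D.b
      ≤ h * |(E.P m (E.star m) j : ℝ) - E.P (m + 1) (E.star m) j|)
    (hp : p ≤ D.alg.suspectProb (E.P m) D.capT (E.star m))
    (hV : m < M → ∀ t, E.ν m ≤ t → t + 1 ≤ E.ν m + h * (K - 1) →
      D.costToGo E (T - t) t (DetectState.running t []) ≤ V)
    (hτ : E.ν (m - 1) ≤ τ + 1) (hτ' : τ + 1 ≤ E.ν (m - 1) + h * (K - 1)) :
    D.costToGo E (T - τ) τ (DetectState.running τ [])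
      ≤ ENNReal.ofReal (D.alg.expRegret E (E.ν (m - 1)) D.capT)
        + (ENNReal.ofReal (1 - p) * T
          + (T * (ENNReal.ofReal (2 * Real.exp (-(2 * D.b ^ 2 / D.w))) * T)
            + (((h * (K - 1) : ℕ) : ℝ≥0∞) + V
              + ENNReal.ofReal (2 * Real.exp (-(2 * D.b ^ 2 / D.w))) * T))) := by
  have hstar := D.costToGo_detecting_star_le E hh hw hb hM hlen h1 hm hchange hV hτ hτ'
  generalize T * (ENNReal.ofReal (2 * Real.exp (-(2 * D.b ^ 2 / D.w))) * T)
        + (((h * (K - 1) : ℕ) : ℝ≥0∞) + V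
          + ENNReal.ofReal (2 * Real.exp (-(2 * D.b ^ 2 / D.w))) * T) = B at hstar ⊢
  have hlast := E.ν_last
  have hνm := hlen m h1 hm
  have hνM := E.ν_mono hm le_rfl
  have hseg : ∀ i < D.capT, E.seg (τ + 1 + i) = m := fun i hi =>
    E.seg_eq h1 hm (by omega) (by omega)
  have hseg' : ∀ i < D.capT, E.seg (E.ν (m - 1) + i) = m := fun i hi =>
    E.seg_eq h1 hm (by omega) (by omega)
  -- The running phase stays inside segment m, so a late start changes neither its law nor its
  -- regret.
  have hstart : D.alg.run E.prefAt (τ + 1) D.capT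
      = D.alg.run E.prefAt (E.ν (m - 1)) D.capT :=
    D.alg.run_congr fun i hi => by
      rw [Environment.prefAt, Environment.prefAt, hseg i hi, hseg' i hi]
  have hstat : D.alg.run E.prefAt (τ + 1) D.capT = D.alg.run (fun _ => E.P m) 1 D.capT :=
    D.alg.run_congr fun i hi => by rw [Environment.prefAt, hseg i hi]
  rw [show T - τ = D.capT + (T - (τ + D.capT)) by omega,
    D.costToGo_running_eq_mean E hM τ _ le_rfl, mean_add]
  refine add_le_add (le_of_eq ?_) ?_
  · rw [D.alg.ofReal_expRegret E hM, ← hstart]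
    refine mean_congr_support fun H hH => ?_
    rw [E.cumRegret_congr]
    intro i hi
    rw [List.length_map, D.alg.length_of_mem_support_run _ _ _ H hH] at hi
    rw [hseg i hi, hseg' i hi]
  · rw [hstat]
    simp only [D.costToGo_running_eq_mean_suspect E _ le_rfl]
    have hpt : ∀ I, D.costToGo E (T - (τ + D.capT)) (τ + D.capT)
        (DetectState.detecting τ I fun _ => []) ≤ ind (I ≠ E.star m) * T + B := by
      intro I
      by_cases hI : I = E.star m
      · rw [hI]
        exact hstar.trans le_add_self
      · rw [ind_of hI, one_mul]
        refine (D.costToGo_le E _ _ _).trans (le_trans ?_ le_self_add)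
        exact_mod_cast Nat.sub_le _ _
    refine (mean_mono _ fun H => mean_mono _ hpt).trans ?_
    simp only [mean_add, mean_const, mean_mul_const]
    gcongr
    exact D.alg.mean_ind_suspect_ne_le _ _ _ hp

/-- The cost of all segments, with the probability of a false or missing alarm left explicit. -/
theorem costToGo_le_sum {h : ℕ} {p : ℝ} (hh : 0 < h) (hw : D.w = h + h)
    (hK : 2 ≤ K) (hb : 0 < D.b) (hM : 1 ≤ M)
    (hlen : ∀ i, 1 ≤ i → i ≤ M → D.capT + 3 * (h * (K - 1)) + E.ν (i - 1) ≤ E.ν i)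
    (hchange : ∀ m, 1 ≤ m → m < M → ∃ j, 2 * D.b
      ≤ h * |(E.P m (E.star m) j : ℝ) - E.P (m + 1) (E.star m) j|)
    (hp : ∀ m, 1 ≤ m → m ≤ M → p ≤ D.alg.suspectProb (E.P m) D.capT (E.star m)) :
    D.costToGo E T 0 (DetectState.running 0 [])
      ≤ ∑ m ∈ Finset.Icc 1 M, (ENNReal.ofReal (D.alg.expRegret E (E.ν (m - 1)) D.capT)
        + (ENNReal.ofReal (1 - p) * T
          + (T * (ENNReal.ofReal (2 * Real.exp (-(2 * D.b ^ 2 / D.w))) * T)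
            + (((h * (K - 1) : ℕ) : ℝ≥0∞)
              + ENNReal.ofReal (2 * Real.exp (-(2 * D.b ^ 2 / D.w))) * T)))) := by
  set A : ℕ → ℝ≥0∞ := fun m => ENNReal.ofReal (D.alg.expRegret E (E.ν (m - 1)) D.capT)
        + (ENNReal.ofReal (1 - p) * T
          + (T * (ENNReal.ofReal (2 * Real.exp (-(2 * D.b ^ 2 / D.w))) * T)
            + (((h * (K - 1) : ℕ) : ℝ≥0∞)
              + ENNReal.ofReal (2 * Real.exp (-(2 * D.b ^ 2 / D.w))) * T)))
  -- Induction on the number k of later segments. It must allow every restart within L steps, since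
  -- the detection delay is random.
  have key : ∀ k m, m + k = M → 1 ≤ m → ∀ τ, E.ν (m - 1) ≤ τ + 1 →
      τ + 1 ≤ E.ν (m - 1) + h * (K - 1) →
      D.costToGo E (T - τ) τ (DetectState.running τ []) ≤ ∑ i ∈ Finset.Icc m M, A i := by
    intro k
    induction k with
    | zero =>
      intro m hmk h1 τ hτ hτ'
      obtain rfl : m = M := by omega
      refine (D.costToGo_running_le E (V := 0) hh hw hb hM hlen h1 le_rfl
        (fun hlt => absurd hlt (lt_irrefl _)) (hp m h1 le_rfl)
        (fun hlt => absurd hlt (lt_irrefl _)) hτ hτ').trans_eq ?_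
      simp [A]
    | succ k ih =>
      intro m hmk h1 τ hτ hτ'
      refine (D.costToGo_running_le E (V := ∑ i ∈ Finset.Icc (m + 1) M, A i) hh hw hb hM hlen h1
        (by omega) (hchange m h1) (hp m h1 (by omega))
        (fun _ t ht ht' => ih (m + 1) (by omega) (by omega) t ?_ ?_) hτ hτ').trans_eq ?_
      · rw [Nat.add_sub_cancel]
        omega
      · rw [Nat.add_sub_cancel]
        omega
      · rw [← Finset.add_sum_Ioc_eq_sum_Icc (show m ≤ M by omega),
          ← Finset.Icc_succ_left_eq_Ioc]
        simp only [A, Order.succ_eq_add_one]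
        ring
  have hpos : 0 < h * (K - 1) := Nat.mul_pos hh (by omega)
  refine key (M - 1) 1 (by omega) le_rfl 0 ?_ ?_
  · rw [Nat.sub_self, E.ν_zero]
  · rw [Nat.sub_self, E.ν_zero]
    omega

/-- The bound on the expected regret of DETECT with the probability of a false or missing alarm
left explicit. -/
theorem expRegret_le {h : ℕ} {p : ℝ} (hh : 0 < h) (hw : D.w = h + h)
    (hK : 2 ≤ K) (hb : 0 < D.b) (hM : 1 ≤ M)
    (hlen : ∀ i, 1 ≤ i → i ≤ M → D.capT + 3 * (h * (K - 1)) + E.ν (i - 1) ≤ E.ν i)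
    (hchange : ∀ m, 1 ≤ m → m < M → ∃ j, 2 * D.b
      ≤ h * |(E.P m (E.star m) j : ℝ) - E.P (m + 1) (E.star m) j|)
    (hp : ∀ m, 1 ≤ m → m ≤ M → p ≤ D.alg.suspectProb (E.P m) D.capT (E.star m)) :
    D.expRegret E
      ≤ M * ((h : ℝ) * ((K : ℝ) - 1) + 2 * Real.exp (-(2 * D.b ^ 2 / D.w)) * (T ^ 2 + T))
        + (1 - p) * M * T
        + ∑ m ∈ Finset.Icc 1 M, D.alg.expRegret E (E.ν (m - 1)) D.capT := by
  -- p is a lower bound for a probability; nonnegativity is needed to pass between `ENNReal.ofReal`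
  -- and real products.
  have hp1 : 0 ≤ 1 - p := by
    refine sub_nonneg.2 ((hp 1 le_rfl hM).trans ?_)
    exact ENNReal.toReal_le_of_le_ofReal zero_le_one (by
      rw [ENNReal.ofReal_one]
      exact PMF.coe_le_one _ _)
  have hr := fun m => D.alg.expRegret_nonneg E hM (E.ν (m - 1)) D.capT
  have hcast : ((h * (K - 1) : ℕ) : ℝ) = (h : ℝ) * ((K : ℝ) - 1) := by
    push_cast [Nat.cast_sub (show 1 ≤ K by omega)]
    ring
  have hbound := D.costToGo_le_sum E hh hw hK hb hM hlen hchange hp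
  rw [D.expRegret_eq E hM]
  set ε := 2 * Real.exp (-(2 * D.b ^ 2 / D.w)) with hε
  have hε0 : 0 ≤ ε := by positivity
  have hterm : ∀ m, ENNReal.ofReal (D.alg.expRegret E (E.ν (m - 1)) D.capT)
        + (ENNReal.ofReal (1 - p) * T + (T * (ENNReal.ofReal ε * T)
            + (((h * (K - 1) : ℕ) : ℝ≥0∞) + ENNReal.ofReal ε * T)))
      = ENNReal.ofReal (D.alg.expRegret E (E.ν (m - 1)) D.capT
        + ((1 - p) * T + (T * (ε * T) + (((h * (K - 1) : ℕ) : ℝ) + ε * T)))) := by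
    intro m
    have hT0 : (0 : ℝ) ≤ T := Nat.cast_nonneg T
    rw [ENNReal.ofReal_add (hr m) (by positivity),
      ENNReal.ofReal_add (by positivity) (by positivity),
      ENNReal.ofReal_add (by positivity) (by positivity),
      ENNReal.ofReal_add (by positivity) (by positivity), ENNReal.ofReal_mul hp1,
      ENNReal.ofReal_mul hT0, ENNReal.ofReal_mul hε0, ENNReal.ofReal_natCast,
      ENNReal.ofReal_natCast]
  simp only [hterm] at hbound
  have hnn : ∀ m, 0 ≤ D.alg.expRegret E (E.ν (m - 1)) D.capT
      + ((1 - p) * T + (T * (ε * T) + (((h * (K - 1) : ℕ) : ℝ) + ε * T))) := fun m =>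
    add_nonneg (hr m) (by positivity)
  rw [← ENNReal.ofReal_sum_of_nonneg fun m _ => hnn m] at hbound
  refine (ENNReal.toReal_le_of_le_ofReal (Finset.sum_nonneg fun m _ => hnn m) hbound).trans_eq ?_
  rw [Finset.sum_add_distrib, Finset.sum_const, Nat.card_Icc, hcast, nsmul_eq_mul,
    Nat.add_sub_cancel]
  ring

end Detect

/-! ### The minimal segmental change -/

namespace Environment

variable {K M T : ℕ} {E : Environment K M T} {δ : ℝ}

theorem segChange_le_one (m : ℕ) (hK : 2 ≤ K) : E.segChange m ≤ 1 := by
  have : Nonempty (Fin K) := ⟨⟨0, by omega⟩⟩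
  refine ciSup_le fun j => abs_sub_le_iff.2 ⟨?_, ?_⟩
  · linarith [(E.P (m + 1) (E.star m) j).2.2, (E.P m (E.star m) j).2.1]
  · linarith [(E.P (m + 1) (E.star m) j).2.1, (E.P m (E.star m) j).2.2]

theorem IsMinSegChange.le_one (hδ : E.IsMinSegChange δ) (hK : 2 ≤ K) : δ ≤ 1 := by
  unfold IsMinSegChange at hδ
  split_ifs at hδ
  · exact hδ.2
  · obtain ⟨⟨m, -, rfl⟩, -⟩ := hδ
    exact segChange_le_one m hK

theorem IsMinSegChange.exists_le (hδ : E.IsMinSegChange δ) (hK : 2 ≤ K) {m : ℕ} (h1 : 1 ≤ m)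
    (hm : m < M) : ∃ j, δ ≤ |(E.P m (E.star m) j : ℝ) - E.P (m + 1) (E.star m) j| := by
  have : Nonempty (Fin K) := ⟨⟨0, by omega⟩⟩
  rw [IsMinSegChange, if_neg (by omega)] at hδ
  obtain ⟨j, hj⟩ := exists_eq_ciSup_of_finite
    (f := fun j : Fin K => |(E.P (m + 1) (E.star m) j : ℝ) - (E.P m (E.star m) j : ℝ)|)
  refine ⟨j, ?_⟩
  rw [abs_sub_comm]
  exact (hδ.2 ⟨m, ⟨h1, by omega⟩, rfl⟩).trans_eq hj.symm

end Environment

end DuelingBandits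

end

/-! ### The choice of the parameters -/

theorem corollary2 :
    ∃ C : ℝ, 0 < C ∧
      ∀ (K M T : ℕ) (E : DuelingBandits.Environment K M T) (D : DuelingBandits.Detect K)
        (c δ p : ℝ),
        2 ≤ K → 2 ≤ T →
        -- `δ` is the minimal segmental change, and it is positive
        E.IsMinSegChange δ → 0 < δ →
        -- the choice of the parameters
        D.b = Real.sqrt (2 * (D.w : ℝ) * Real.log (T : ℝ)) →
        c = Real.sqrt (8 * Real.log (T : ℝ) / (D.w : ℝ)) →
        IsLeast {n : ℕ | Even n ∧ 32 * Real.log (T : ℝ) / δ ^ 2 ≤ (n : ℝ)} D.w →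
        -- every segment has length at least `capT + (3 / 2) * w * (K - 1)`
        (∀ m, 1 ≤ m → m ≤ M →
          (D.capT : ℝ) + 3 / 2 * ((D.w : ℝ) * ((K : ℝ) - 1)) ≤
            (E.ν m : ℝ) - (E.ν (m - 1) : ℝ)) →
        -- `p` bounds the identification probabilities of the black-box algorithm from below
        (∀ m, 1 ≤ m → m ≤ M → p ≤ D.alg.suspectProb (E.P m) D.capT (E.star m)) →
        (0 < D.b ∧ 0 < c ∧ 2 * D.b / (D.w : ℝ) + c ≤ δ) ∧
        D.expRegret E ≤
          C * ((K : ℝ) * (M : ℝ) * Real.log (T : ℝ) / δ ^ 2)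
            + (1 - p) * (M : ℝ) * (T : ℝ)
            + ∑ m ∈ Finset.Icc 1 M, D.alg.expRegret E (E.ν (m - 1)) D.capT := by
  -- 20 = 18 + 2: the delay L contributes 18 and the false or missing alarms contribute 2.
  refine ⟨20, by norm_num, ?_⟩
  intro K M T E D c δ p hK hT hδ hδ0 hb hc hw hlen hp
  have hM := E.one_le_M hT
  have hδ1 := hδ.le_one hK
  have hT' : (2 : ℝ) ≤ T := by exact_mod_cast hT
  have hlog : 1 / 2 < Real.log T :=
    lt_of_lt_of_le (by linarith [Real.log_two_gt_d9]) (Real.log_le_log two_pos hT')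
  set l := Real.log (T : ℝ) with hl
  have hl0 : 0 < l := by linarith
  have hratio : l ≤ l / δ ^ 2 := by
    rw [le_div_iff₀ (by positivity)]
    nlinarith [pow_le_one₀ (n := 2) hδ0.le hδ1]
  obtain ⟨⟨⟨h, hw2⟩, hwlow⟩, hmin⟩ := hw
  have hwR : (D.w : ℝ) = 2 * h := by
    rw [hw2]
    push_cast
    ring
  have hw0 : (0 : ℝ) < D.w := lt_of_lt_of_le (by positivity) hwlow
  have hh : 0 < h := by
    rw [hwR] at hw0
    have : (0 : ℝ) < h := by linarith
    exact_mod_cast this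
  have hh0 : (0 : ℝ) < h := by exact_mod_cast hh
  -- Otherwise w - 2 would be a smaller admissible even number.
  have hup : (D.w : ℝ) ≤ 32 * l / δ ^ 2 + 2 := by
    by_contra hlt
    rw [not_le] at hlt
    have hmem : D.w - 2 ∈ {n : ℕ | Even n ∧ 32 * l / δ ^ 2 ≤ (n : ℝ)} := by
      refine ⟨⟨h - 1, by omega⟩, ?_⟩
      rw [Nat.cast_sub (by omega)]
      push_cast
      linarith
    have := hmin hmem
    omega
  have hb0 : 0 < D.b := by
    rw [hb]
    positivity
  have hbsq : D.b ^ 2 = 2 * D.w * l := by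
    rw [hb, Real.sq_sqrt (by positivity)]
  have hcb : c = 2 * D.b / D.w := by
    rw [hc, Real.sqrt_eq_iff_mul_self_eq_of_pos (by positivity), ← pow_two, div_pow, mul_pow, hbsq]
    field_simp
    norm_num
  -- Squared, with w = 2h and b² = 2wl, this reads 32l ≤ wδ², which explains the constant 32. Since
  -- c = 2b/w, it is also the claim 2b/w + c ≤ δ.
  have hbδ : 2 * D.b ≤ h * δ := by
    refine (pow_le_pow_iff_left₀ (by positivity) (by positivity) two_ne_zero).1 ?_
    rw [div_le_iff₀ (by positivity), hwR] at hwlow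
    rw [mul_pow, hbsq, hwR]
    nlinarith
  refine ⟨⟨hb0, by rw [hcb]; positivity, ?_⟩, ?_⟩
  · rw [hcb, ← add_div, div_le_iff₀ hw0, hwR]
    linarith
  have hlen' : ∀ i, 1 ≤ i → i ≤ M → D.capT + 3 * (h * (K - 1)) + E.ν (i - 1) ≤ E.ν i := by
    intro i h1 hi
    have := hlen i h1 hi
    have hKc : ((K - 1 : ℕ) : ℝ) = (K : ℝ) - 1 := by
      rw [Nat.cast_sub (by omega), Nat.cast_one]
    rw [hwR, ← hKc] at this
    have hreal : (D.capT : ℝ) + 3 * (h * ((K - 1 : ℕ) : ℝ)) + E.ν (i - 1) ≤ E.ν i := by linarith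
    exact_mod_cast hreal
  refine (D.expRegret_le E hh hw2 hK hb0 hM hlen' (fun m h1 hm => ?_) hp).trans ?_
  · obtain ⟨j, hj⟩ := hδ.exists_le hK h1 hm
    exact ⟨j, hbδ.trans (by gcongr)⟩
  · refine add_le_add_left (add_le_add_left ?_ _) _
    have hexp : Real.exp (-(2 * D.b ^ 2 / D.w)) = 1 / (T : ℝ) ^ 4 := by
      rw [hbsq, show 2 * (2 * (D.w : ℝ) * l) / D.w = (4 : ℕ) * l by field_simp; norm_num,
        Real.exp_neg, Real.exp_nat_mul, hl, Real.exp_log (by linarith), one_div]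
    have hsmall : 2 * Real.exp (-(2 * D.b ^ 2 / D.w)) * ((T : ℝ) ^ 2 + T) ≤ 1 := by
      rw [hexp, mul_one_div, div_mul_eq_mul_div, div_le_one (by positivity)]
      nlinarith [pow_pos (lt_of_lt_of_le two_pos hT') 2,
        mul_nonneg (sub_nonneg.2 hT') (pow_nonneg (lt_of_lt_of_le two_pos hT').le 2),
        mul_nonneg (sub_nonneg.2 hT') (pow_nonneg (lt_of_lt_of_le two_pos hT').le 3)]
    have hK' : (2 : ℝ) ≤ K := by exact_mod_cast hK
    -- h ≤ 16 l/δ² + 1, and 1 ≤ 2 l/δ² because l > 1/2 and δ ≤ 1.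
    have hhup : (h : ℝ) ≤ 18 * (l / δ ^ 2) := by
      rw [mul_div_assoc] at hup
      linarith
    have hhK : (h : ℝ) * ((K : ℝ) - 1) ≤ 18 * (l / δ ^ 2) * K :=
      mul_le_mul hhup (by linarith) (by linarith) (by positivity)
    have hone : 1 ≤ 2 * (l / δ ^ 2) * K := by nlinarith
    calc (M : ℝ) * ((h : ℝ) * ((K : ℝ) - 1)
          + 2 * Real.exp (-(2 * D.b ^ 2 / D.w)) * ((T : ℝ) ^ 2 + T))
        ≤ M * (20 * (l / δ ^ 2) * K) := by
          gcongr
          linarith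
      _ = 20 * ((K : ℝ) * M * l / δ ^ 2) := by ring
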